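/- Let $n\ge 0$ and $d\ge 1$ be integers and let $U$ be a finite set of non-constant multilinear monomials $x^S=\prod_{i\in S}x_i$ ($\emptyset\ne S\subseteq\{1,\dots,n\}$), each of degree $|S|\le d$. Put $u=|U|$ and let $u_i$ be the number of monomials in $U$ that contain the variable $x_i$. Let $\mathcal L_U$ be the set of the polynomials $h=\sum_{x^S\in U}h_S x^S$ with all $h_S\in\{1,-1\}$, and let $$M(U)=\inf_{h\in\mathcal L_U}\ \sup_{x\in[-1,1]^n}|h(x)| .$$ For every $h\in\mathcal L_U$ the supremum over $[-1,1]^n$ equals $\max_{x\in\{\pm1\}^n}|h(x)|$, so that also $M(U)=\min_{h\in\mathcal L_U}\max_{x\in\{\pm1\}^n}|h(x)|$. (i) For every fixed $d\ge 1$, $M(U)=\Theta_d\bigl(\sum_{i=1}^n\sqrt{u_i}\bigr)$: there are constants $c,C>0$ depending only on $d$ such that $c\sum_i\sqrt{u_i}\le M(U)\le C\sum_i\sqrt{u_i}$ for all $n$ and all such $U$. (ii) More precisely, without assumptions on $d$, $$\max\Bigl\{\frac{1}{3^{d-1}\,2^{5/2}\,(d-1)^{3/2}\,d}\sum_{i=1}^n\sqrt{u_i},\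 \sqrt u\Bigr\}\ \le\ M(U)\ \le\ \min\Bigl\{3.34\sum_{i=1}^n\sqrt{u_i},\ \sqrt{2(n+1)u}\Bigr\},$$ where for $d=1$ the fraction in the lower bound, which is then undefined, is replaced by $1$. -/

import Mathlib

open scoped BigOperators

noncomputable section

namespace Littlewood

/-- A multilinear set of monomials in `n` variables is a finite hypergraph `U` on `Fin n`;
the edge `S` stands for the monomial `x^S = ∏ i ∈ S, x_i`, of total degree `#S`. -/
def edgeMonomial {n : ℕ} (S : Finset (Fin n)) : MvPolynomial (Fin n) ℝ :=
  ∏ i ∈ S, MvPolynomial.X i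

/-- The polynomials `∑ S ∈ U, h_S x^S` with every `h_S` equal to `1` or `-1`. -/
def family {n : ℕ} (U : Finset (Finset (Fin n))) : Set (MvPolynomial (Fin n) ℝ) :=
  {h | ∃ c : Finset (Fin n) → ℝ, (∀ S ∈ U, c S = 1 ∨ c S = -1) ∧
    h = ∑ S ∈ U, MvPolynomial.C (c S) * edgeMonomial S}

/-- `U` contains no constant monomial, and all its monomials have degree at most `d`. -/
def IsBoundedFamily {n : ℕ} (d : ℕ) (U : Finset (Finset (Fin n))) : Prop :=
  ∀ S ∈ U, S.Nonempty ∧ S.card ≤ d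

/-- `u_i`, the number of monomials of `U` containing the variable `i`. -/
def varDegree {n : ℕ} (U : Finset (Finset (Fin n))) (i : Fin n) : ℕ :=
  (U.filter (fun S => i ∈ S)).card

/-- The sum of `√u_i` over all variables. -/
def sumSqrt {n : ℕ} (U : Finset (Finset (Fin n))) : ℝ :=
  ∑ i : Fin n, Real.sqrt (varDegree U i)

/-- The supremum of `|h(x)|` over the points `x` all of whose coordinates lie in `X`. -/
def supNorm {n : ℕ} (X : Set ℝ) (h : MvPolynomial (Fin n) ℝ) : ℝ :=
  ⨆ x : Fin n → X, |MvPolynomial.eval (fun i => (x i : ℝ)) h|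

/-- The infimum of the sup norm on `X ^ n` over the family of `U`. -/
def infNorm {n : ℕ} (X : Set ℝ) (U : Finset (Finset (Fin n))) : ℝ :=
  ⨅ h : family U, supNorm X (h : MvPolynomial (Fin n) ℝ)

/-- The supremum defining `supNorm` is a genuine one on a compact set, as are `[-1, 1]`
and `{-1, 1}`. -/
theorem bddAbove_supNorm {n : ℕ} {X : Set ℝ} (hX : IsCompact X)
    (h : MvPolynomial (Fin n) ℝ) :
    BddAbove (Set.range fun x : Fin n → X =>
      |MvPolynomial.eval (fun i => (x i : ℝ)) h|) := by
  have : CompactSpace X := isCompact_iff_compactSpace.mp hX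
  refine (isCompact_range ?_).bddAbove
  exact ((MvPolynomial.continuous_eval h).comp (by fun_prop)).abs

/-- The infimum defining `infNorm` is taken over a nonempty family, of nonnegative numbers. -/
theorem family_nonempty {n : ℕ} (U : Finset (Finset (Fin n))) : (family U).Nonempty :=
  ⟨_, fun _ => 1, fun _ _ => Or.inl rfl, rfl⟩

theorem supNorm_nonneg {n : ℕ} (X : Set ℝ) (h : MvPolynomial (Fin n) ℝ) : 0 ≤ supNorm X h :=
  Real.iSup_nonneg fun _ => abs_nonneg _

end Littlewood

end

open scoped BigOperators

noncomputable section

namespace Littlewood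

/-! ### Moments of multilinear polynomials on the discrete cube -/

section Cube

variable {ι : Type*}

/-! A multilinear polynomial is affine in each variable, so its extremes over the solid cube occur
at vertices. Parseval over the vertices gives the lower bound `√u`.

The other lower bound restricts `h` to segments inside the solid cube. Markov's inequality at the
endpoint `x`, for the segment to `y = (sign ∂ᵢh(x))ᵢ`, bounds `∑ |∂ᵢh(x)| - ∑ xᵢ ∂ᵢh(x)` by `2 d²
‖h‖` (`sum_sub_mul_partial_le`). By Euler's identity the subtracted sum has no constant term, so it
averages to zero over the vertices, and `2 d² ‖h‖` bounds the sum of the `L¹` norms of the `∂ᵢh`.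
These have degree at most `d - 1` and `L²` norm `√uᵢ`, and `bonami` makes `L¹` at least `3^{-(d-1)}
L²`. For `d = 1` one evaluates at the signs of the coefficients instead.

For the upper bounds, random signs, exponential moments and a union bound over vertices give
`√(2(n+1)u)` (`exists_signs_abs_sum_le`). Sorting the variables by decreasing degree and applying
this separately to the edges that first reach each dyadic block gives `3.34 ∑ √uᵢ`
(`exists_signs_dyadic`). -/

/-- The multilinear polynomial with coefficients `c` in the variables of `W`. -/
def multilin (c : Finset ι → ℝ) (W : Finset ι) (x : ι → ℝ) : ℝ :=
  ∑ S ∈ W.powerset, c S * ∏ i ∈ S, x i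

theorem multilin_congr (c : Finset ι → ℝ) {W : Finset ι} {x y : ι → ℝ}
    (h : ∀ i ∈ W, x i = y i) : multilin c W x = multilin c W y :=
  Finset.sum_congr rfl fun S hS => by
    rw [Finset.prod_congr rfl fun i hi => h i (Finset.mem_powerset.mp hS hi)]

theorem multilin_add_mul (c c' : Finset ι → ℝ) (t : ℝ) (W : Finset ι) (x : ι → ℝ) :
    multilin (fun S => c S + t * c' S) W x = multilin c W x + t * multilin c' W x := by
  unfold multilin
  rw [Finset.mul_sum, ← Finset.sum_add_distrib]
  exact Finset.sum_congr rfl fun S _ => by ring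

variable [DecidableEq ι]

/-- The vertex of the cube `{-1, 1}^ι` whose coordinates equal to `-1` are those in `T`. -/
def vertex (T : Finset ι) (i : ι) : ℝ := if i ∈ T then -1 else 1

theorem multilin_insert (c : Finset ι → ℝ) {a : ι} {W : Finset ι} (ha : a ∉ W) (x : ι → ℝ) :
    multilin c (insert a W) x =
      multilin c W x + x a * multilin (fun S => c (insert a S)) W x := by
  unfold multilin
  rw [Finset.sum_powerset_insert ha, Finset.mul_sum]
  congr 1
  refine Finset.sum_congr rfl fun S hS => ?_
  rw [Finset.prod_insert (fun h => ha (Finset.mem_powerset.mp hS h))]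
  ring

theorem multilin_insert_vertex (c : Finset ι → ℝ) {a : ι} {W T : Finset ι} (ha : a ∉ W)
    (hT : T ⊆ W) :
    multilin c (insert a W) (vertex T) =
      multilin c W (vertex T) + multilin (fun S => c (insert a S)) W (vertex T) := by
  rw [multilin_insert c ha, vertex, if_neg fun h => ha (hT h), one_mul]

theorem multilin_insert_vertex_insert (c : Finset ι → ℝ) {a : ι} {W : Finset ι} (T : Finset ι)
    (ha : a ∉ W) :
    multilin c (insert a W) (vertex (insert a T)) =
      multilin c W (vertex T) - multilin (fun S => c (insert a S)) W (vertex T) := by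
  have h : ∀ i ∈ W, vertex (insert a T) i = vertex T i := fun i hi => by
    have : i ≠ a := fun h => ha (h ▸ hi)
    simp [vertex, this]
  rw [multilin_insert c ha, multilin_congr _ h, multilin_congr _ h]
  simp [vertex]
  ring

/-- Splitting the polynomial as `g + x_a k` and pairing the vertices with `x_a = 1` and `x_a = -1`
gives the values `g + k` and `g - k`. This is the induction step for every moment below. -/
theorem sum_powerset_vertex_insert (c : Finset ι → ℝ) {a : ι} {W : Finset ι} (ha : a ∉ W)
    (F : ℝ → ℝ) :
    ∑ T ∈ (insert a W).powerset, F (multilin c (insert a W) (vertex T)) =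
      ∑ T ∈ W.powerset,
        (F (multilin c W (vertex T) + multilin (fun S => c (insert a S)) W (vertex T)) +
          F (multilin c W (vertex T) - multilin (fun S => c (insert a S)) W (vertex T))) := by
  rw [Finset.sum_powerset_insert ha, ← Finset.sum_add_distrib]
  refine Finset.sum_congr rfl fun T hT => ?_
  rw [multilin_insert_vertex c ha (Finset.mem_powerset.mp hT),
    multilin_insert_vertex_insert c T ha]

/-- The average over the vertices of a multilinear polynomial is its constant coefficient. -/
theorem sum_multilin_vertex (W : Finset ι) : ∀ c : Finset ι → ℝ,
    ∑ T ∈ W.powerset, multilin c W (vertex T) = 2 ^ W.card * c ∅ := by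
  induction W using Finset.induction_on with
  | empty => intro c; simp [multilin]
  | insert a W ha ih =>
    intro c
    rw [sum_powerset_vertex_insert c ha (fun y => y), Finset.card_insert_of_notMem ha]
    calc _ = ∑ T ∈ W.powerset, 2 * multilin c W (vertex T) :=
          Finset.sum_congr rfl fun T _ => by ring
      _ = _ := by rw [← Finset.mul_sum, ih c]; ring

theorem parseval (W : Finset ι) : ∀ c : Finset ι → ℝ,
    ∑ T ∈ W.powerset, multilin c W (vertex T) ^ 2 = 2 ^ W.card * ∑ S ∈ W.powerset, c S ^ 2 := by
  induction W using Finset.induction_on with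
  | empty => intro c; simp [multilin]
  | insert a W ha ih =>
    intro c
    rw [sum_powerset_vertex_insert c ha (fun y => y ^ 2), Finset.card_insert_of_notMem ha,
      Finset.sum_powerset_insert ha]
    calc _ = 2 * ∑ T ∈ W.powerset, multilin c W (vertex T) ^ 2 +
          2 * ∑ T ∈ W.powerset, multilin (fun S => c (insert a S)) W (vertex T) ^ 2 := by
          rw [Finset.mul_sum, Finset.mul_sum, ← Finset.sum_add_distrib]
          exact Finset.sum_congr rfl fun T _ => by ring
      _ = _ := by rw [ih, ih]; ring

/-- Bonami's lemma: the fourth moment of a multilinear polynomial of degree at most `d` is at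
most `9 ^ d` times the square of its second moment. -/
theorem bonami (W : Finset ι) : ∀ (d : ℕ) (c : Finset ι → ℝ),
    (∀ S ∈ W.powerset, d < S.card → c S = 0) →
    2 ^ W.card * ∑ T ∈ W.powerset, multilin c W (vertex T) ^ 4 ≤
      9 ^ d * (∑ T ∈ W.powerset, multilin c W (vertex T) ^ 2) ^ 2 := by
  induction W using Finset.induction_on with
  | empty =>
    intro d c _
    have : (1 : ℝ) ≤ 9 ^ d := one_le_pow₀ (by norm_num)
    simp only [Finset.card_empty, pow_zero, Finset.powerset_empty, Finset.sum_singleton, one_mul,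
      ← pow_mul]
    exact le_mul_of_one_le_left (by positivity) this
  | insert a W ha ih =>
    intro d c hc
    rw [sum_powerset_vertex_insert c ha (fun y => y ^ 4),
      sum_powerset_vertex_insert c ha (fun y => y ^ 2), Finset.card_insert_of_notMem ha]
    set g : Finset ι → ℝ := fun T => multilin c W (vertex T) with hg
    set k : Finset ι → ℝ := fun T => multilin (fun S => c (insert a S)) W (vertex T) with hk
    set w : ℝ := 2 ^ W.card with hw
    have hw0 : 0 < w := by positivity
    set G2 := ∑ T ∈ W.powerset, g T ^ 2 with hG2
    set K2 := ∑ T ∈ W.powerset, k T ^ 2 with hK2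
    set G4 := ∑ T ∈ W.powerset, g T ^ 4 with hG4
    set K4 := ∑ T ∈ W.powerset, k T ^ 4 with hK4
    set X := ∑ T ∈ W.powerset, g T ^ 2 * k T ^ 2 with hX
    have hG20 : 0 ≤ G2 := Finset.sum_nonneg fun _ _ => by positivity
    have hK20 : 0 ≤ K2 := Finset.sum_nonneg fun _ _ => by positivity
    have hX0 : 0 ≤ X := Finset.sum_nonneg fun _ _ => by positivity
    have hK40 : 0 ≤ K4 := Finset.sum_nonneg fun _ _ => by positivity
    have e4 : ∑ T ∈ W.powerset, ((g T + k T) ^ 4 + (g T - k T) ^ 4) =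
        2 * (G4 + 6 * X + K4) := by
      rw [hG4, hX, hK4, Finset.mul_sum, ← Finset.sum_add_distrib, ← Finset.sum_add_distrib,
        Finset.mul_sum]
      exact Finset.sum_congr rfl fun T _ => by ring
    have e2 : ∑ T ∈ W.powerset, ((g T + k T) ^ 2 + (g T - k T) ^ 2) = 2 * (G2 + K2) := by
      rw [hG2, hK2, ← Finset.sum_add_distrib, Finset.mul_sum]
      exact Finset.sum_congr rfl fun T _ => by ring
    rw [e4, e2]
    have hGd : w * G4 ≤ 9 ^ d * G2 ^ 2 := by
      refine ih d c fun S hS => hc S (Finset.mem_powerset.mpr ?_)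
      exact (Finset.mem_powerset.mp hS).trans (Finset.subset_insert a W)
    have hcs : X ^ 2 ≤ G4 * K4 := by
      have := Finset.sum_mul_sq_le_sq_mul_sq W.powerset (fun T => g T ^ 2) (fun T => k T ^ 2)
      simpa only [← pow_mul] using this
    have hins : ∀ S ∈ W.powerset, (insert a S).card = S.card + 1 := fun S hS =>
      Finset.card_insert_of_notMem fun h => ha (Finset.mem_powerset.mp hS h)
    have hsub : ∀ S ∈ W.powerset, insert a S ∈ (insert a W).powerset := fun S hS =>
      Finset.mem_powerset.mpr (Finset.insert_subset_insert a (Finset.mem_powerset.mp hS))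
    -- The factor 9 is gained because `k` has degree at most `d - 1`, or vanishes when `d = 0`.
    have hKd : 9 * (w * K4) ≤ 9 ^ d * K2 ^ 2 := by
      rcases d with _ | d
      · have hk0 : ∀ T, k T = 0 := fun T =>
          Finset.sum_eq_zero fun S hS => by
            change c (insert a S) * _ = 0
            rw [hc _ (hsub S hS) (by rw [hins S hS]; omega), zero_mul]
        simp [hK4, hK2, hk0]
      · have := ih d (fun S => c (insert a S)) fun S hS h =>
          hc _ (hsub S hS) (by rw [hins S hS]; omega)
        rw [pow_succ]
        have h9 : w * K4 ≤ 9 ^ d * K2 ^ 2 := this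
        linarith
    -- Cauchy–Schwarz turns the gain of 9 into a gain of 3, just enough for `6 X` to fit the cross
    -- term of `(G2 + K2) ^ 2`.
    have hXd : 3 * (w * X) ≤ 9 ^ d * (G2 * K2) := by
      refine abs_le_of_sq_le_sq' ?_ (by positivity) |>.2
      calc (3 * (w * X)) ^ 2 = 9 * w ^ 2 * X ^ 2 := by ring
        _ ≤ 9 * w ^ 2 * (G4 * K4) := by gcongr
        _ = (w * G4) * (9 * (w * K4)) := by ring
        _ ≤ (9 ^ d * G2 ^ 2) * (9 ^ d * K2 ^ 2) := by gcongr
        _ = _ := by ring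
    have h9 : (0 : ℝ) < 9 ^ d := by positivity
    have hK' : w * K4 ≤ 9 ^ d * K2 ^ 2 := by nlinarith [mul_nonneg hw0.le hK40]
    rw [pow_succ]
    nlinarith

/-- The first moment of a multilinear polynomial of degree at most `d` is at least `3 ^ (-d)`
times its `L²` norm. -/
theorem sqrt_sum_sq_le_sum_abs (W : Finset ι) (d : ℕ) (c : Finset ι → ℝ)
    (hc : ∀ S ∈ W.powerset, d < S.card → c S = 0) :
    2 ^ W.card * Real.sqrt (∑ S ∈ W.powerset, c S ^ 2) ≤
      3 ^ d * ∑ T ∈ W.powerset, |multilin c W (vertex T)| := by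
  have hb := bonami W d c hc
  rw [parseval] at hb
  set A := ∑ S ∈ W.powerset, c S ^ 2 with hA
  set w : ℝ := 2 ^ W.card with hw
  have hw0 : 0 < w := by positivity
  have hA0 : 0 ≤ A := Finset.sum_nonneg fun _ _ => by positivity
  rcases hA0.eq_or_lt with h0 | hpos
  · rw [← h0, Real.sqrt_zero, mul_zero]
    exact mul_nonneg (by positivity) (Finset.sum_nonneg fun _ _ => abs_nonneg _)
  set s := Real.sqrt A with hs
  have hs0 : 0 < s := Real.sqrt_pos.mpr hpos
  have hsA : s ^ 2 = A := Real.sq_sqrt hA0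
  set τ : ℝ := 3 ^ d * s with hτ
  have hτ0 : 0 < τ := by positivity
  -- The difference is `y (y - τ)² (y + 2τ)`. The choice of `τ` makes the fourth moment at most `τ²`
  -- times the second, so summing leaves `2τ²` times the second moment on the left.
  have hpt : ∀ y : ℝ, 0 ≤ y → 3 * τ ^ 2 * y ^ 2 - y ^ 4 ≤ 2 * τ ^ 3 * y := fun y hy => by
    nlinarith [mul_nonneg (mul_nonneg hy (sq_nonneg (y - τ))) (by positivity : 0 ≤ y + 2 * τ)]
  have hsum : 3 * τ ^ 2 * (w * A) - ∑ T ∈ W.powerset, multilin c W (vertex T) ^ 4 ≤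
      2 * τ ^ 3 * ∑ T ∈ W.powerset, |multilin c W (vertex T)| := by
    rw [hA, hw, ← parseval, Finset.mul_sum, Finset.mul_sum, ← Finset.sum_sub_distrib]
    refine Finset.sum_le_sum fun T _ => ?_
    have := hpt |multilin c W (vertex T)| (abs_nonneg _)
    rwa [sq_abs, (by decide : Even 4).pow_abs] at this
  set Q := ∑ T ∈ W.powerset, multilin c W (vertex T) ^ 4
  set L := ∑ T ∈ W.powerset, |multilin c W (vertex T)|
  have h9 : (9 : ℝ) ^ d = (3 ^ d) ^ 2 := by rw [← pow_mul, mul_comm, pow_mul]; norm_num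
  have hQ : Q ≤ τ ^ 2 * w * A := by
    refine le_of_mul_le_mul_left (hb.trans_eq ?_) hw0
    rw [h9, hτ, mul_pow _ s, hsA]
    ring
  have h2 : 2 * τ ^ 2 * (w * A) ≤ 2 * τ ^ 2 * (τ * L) := by nlinarith
  have h3 : w * A ≤ τ * L := le_of_mul_le_mul_left h2 (by positivity)
  refine le_of_mul_le_mul_left ?_ hs0
  calc s * (w * s) = w * A := by rw [← hsA]; ring
    _ ≤ τ * L := h3
    _ = s * (3 ^ d * L) := by rw [hτ]; ring

/-! ### The solid cube, Markov's inequality and partial derivatives -/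

/-- On the solid cube a multilinear polynomial is bounded by its maximum over the vertices. -/
theorem abs_multilin_le_of_vertex {x : ι → ℝ} (hx : ∀ i, x i ∈ Set.Icc (-1 : ℝ) 1) {M : ℝ}
    (W : Finset ι) : ∀ c : Finset ι → ℝ,
    (∀ T ∈ W.powerset, |multilin c W (vertex T)| ≤ M) → |multilin c W x| ≤ M := by
  induction W using Finset.induction_on with
  | empty => intro c h; simpa [multilin] using h ∅ (by simp)
  | insert a W ha ih =>
    intro c h
    -- Freezing `x a` at its value leaves a multilinear polynomial in `W`, whose vertex values are
    -- convex combinations of those at `x a = ±1`.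
    rw [multilin_insert c ha, ← multilin_add_mul]
    refine ih _ fun T hT => ?_
    rw [multilin_add_mul]
    have hTW := Finset.mem_powerset.mp hT
    have h1 := h T (Finset.mem_powerset.mpr (hTW.trans (Finset.subset_insert a W)))
    have h2 := h (insert a T) (Finset.mem_powerset.mpr (Finset.insert_subset_insert a hTW))
    rw [multilin_insert_vertex c ha hTW] at h1
    rw [multilin_insert_vertex_insert c T ha] at h2
    rw [abs_le] at h1 h2 ⊢
    obtain ⟨hl, hr⟩ := hx a
    constructor <;> nlinarith

open Polynomial in
/-- Markov's inequality at an endpoint. -/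
theorem eval_derivative_one_le {n : ℕ} {P : ℝ[X]} {M : ℝ} (hM : 0 < M) (hdeg : P.degree ≤ n)
    (hP : ∀ t ∈ Set.Icc (-1 : ℝ) 1, |P.eval t| ≤ M) :
    (derivative P).eval 1 ≤ (n : ℝ) ^ 2 * M := by
  have h := Chebyshev.eval_iterate_derivative_le_of_forall_abs_le_one (n := n)
    (P := C M⁻¹ * P) (k := 1) (x := 1) le_rfl
    (by rwa [degree_C_mul (inv_ne_zero hM.ne')])
    (fun t ht => by
      rw [eval_mul, eval_C, abs_mul, abs_of_pos (inv_pos.mpr hM), inv_mul_le_one₀ hM]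
      exact hP t ht)
  simp only [Function.iterate_one, derivative_C_mul, eval_mul, eval_C,
    Chebyshev.derivative_T_eval_one, Int.cast_natCast] at h
  rwa [inv_mul_le_iff₀ hM, mul_comm] at h

theorem vertex_mem_Icc (T : Finset ι) (i : ι) : vertex T i ∈ Set.Icc (-1 : ℝ) 1 := by
  unfold vertex; split_ifs <;> simp

section Derivative

variable [Fintype ι]

/-- The coefficients of the partial derivative in the variable `i`. -/
def partialCoeff (i : ι) (c : Finset ι → ℝ) (S : Finset ι) : ℝ :=
  if i ∈ S then 0 else c (insert i S)

/-- Adjoining `i` is a bijection from the sets avoiding `i` to those containing it; this reindexes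
derivative coefficients by the original monomials. -/
theorem sum_ite_insert (i : ι) (f : Finset ι → ℝ) :
    ∑ S : Finset ι, (if i ∈ S then 0 else f (insert i S)) =
      ∑ S : Finset ι, if i ∈ S then f S else 0 := by
  have h1 : ∑ S : Finset ι, (if i ∈ S then 0 else f (insert i S)) =
      ∑ S ∈ Finset.univ.filter (fun S : Finset ι => i ∉ S), f (insert i S) := by
    rw [Finset.sum_filter]
    exact Finset.sum_congr rfl fun S _ => by by_cases h : i ∈ S <;> simp [h]
  rw [h1, ← Finset.sum_filter]
  refine Finset.sum_nbij' (fun S => insert i S) (fun S => S.erase i) ?_ ?_ ?_ ?_ ?_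
  · intro S _; simp
  · intro S _; simp
  · intro S hS; exact Finset.erase_insert (by simpa using hS)
  · intro S hS; exact Finset.insert_erase (by simpa using hS)
  · intro S _; rfl

theorem multilin_partialCoeff (i : ι) (c : Finset ι → ℝ) (x : ι → ℝ) :
    multilin (partialCoeff i c) Finset.univ x =
      ∑ S : Finset ι, if i ∈ S then c S * ∏ j ∈ S.erase i, x j else 0 := by
  rw [← sum_ite_insert i fun S => c S * ∏ j ∈ S.erase i, x j]
  unfold multilin partialCoeff
  rw [Finset.powerset_univ]
  refine Finset.sum_congr rfl fun S _ => ?_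
  by_cases h : i ∈ S
  · simp [h]
  · simp [h, Finset.erase_insert h]

theorem sum_sq_partialCoeff (i : ι) (c : Finset ι → ℝ) :
    ∑ S : Finset ι, partialCoeff i c S ^ 2 = ∑ S : Finset ι, if i ∈ S then c S ^ 2 else 0 := by
  rw [← sum_ite_insert i fun S => c S ^ 2]
  refine Finset.sum_congr rfl fun S _ => ?_
  unfold partialCoeff
  by_cases h : i ∈ S <;> simp [h]

theorem sum_mul_multilin_partialCoeff (c : Finset ι → ℝ) (x v : ι → ℝ) :
    ∑ i, v i * multilin (partialCoeff i c) Finset.univ x =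
      ∑ S : Finset ι, c S * ∑ i ∈ S, v i * ∏ j ∈ S.erase i, x j := by
  simp only [multilin_partialCoeff, Finset.mul_sum]
  rw [Finset.sum_comm]
  refine Finset.sum_congr rfl fun S _ => ?_
  rw [← Finset.sum_filter_add_sum_filter_not Finset.univ (· ∈ S)]
  simp only [Finset.filter_univ_mem]
  rw [Finset.sum_eq_zero (s := Finset.univ.filter (· ∉ S)), add_zero]
  · exact Finset.sum_congr rfl fun i hi => by rw [if_pos hi]; ring
  · intro i hi
    rw [if_neg (by simpa using hi), mul_zero]

/-- Euler's identity. -/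
theorem sum_self_mul_multilin_partialCoeff (c : Finset ι → ℝ) (x : ι → ℝ) :
    ∑ i, x i * multilin (partialCoeff i c) Finset.univ x =
      multilin (fun S => S.card * c S) Finset.univ x := by
  rw [sum_mul_multilin_partialCoeff, multilin, Finset.powerset_univ]
  refine Finset.sum_congr rfl fun S _ => ?_
  rw [Finset.sum_congr rfl fun i hi => Finset.mul_prod_erase S x hi, Finset.sum_const,
    nsmul_eq_mul]
  ring

open Polynomial in
/-- The directional derivative at a point of the cube, towards another point of the cube. -/
theorem sum_sub_mul_partial_le {d : ℕ} {c : Finset ι → ℝ} {M : ℝ} (hM : 0 < M)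
    (hc : ∀ S, d < S.card → c S = 0)
    (hb : ∀ x : ι → ℝ, (∀ i, x i ∈ Set.Icc (-1 : ℝ) 1) → |multilin c Finset.univ x| ≤ M)
    {x y : ι → ℝ} (hx : ∀ i, x i ∈ Set.Icc (-1 : ℝ) 1) (hy : ∀ i, y i ∈ Set.Icc (-1 : ℝ) 1) :
    ∑ i, (y i - x i) * multilin (partialCoeff i c) Finset.univ x ≤ 2 * (d : ℝ) ^ 2 * M := by
  -- The segment runs from `y` at `t = -1` to `x` at `t = 1`. Its velocity `(x - y) / 2` explains
  -- the minus sign in `P` and the factor 2 in the bound.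
  set ℓ : ι → ℝ[X] := fun i => C ((x i + y i) / 2) + C ((x i - y i) / 2) * X with hℓ
  set P : ℝ[X] := -∑ S : Finset ι, C (c S) * ∏ i ∈ S, ℓ i with hP
  have hev : ∀ t, P.eval t = -multilin c Finset.univ fun i => (ℓ i).eval t := fun t => by
    rw [hP, multilin, Finset.powerset_univ]
    simp [eval_finsetSum, eval_prod]
  have hdeg : P.degree ≤ d := by
    rw [hP, degree_neg]
    refine (degree_sum_le _ _).trans (Finset.sup_le fun S _ => ?_)
    by_cases hS : c S = 0
    · simp [hS]
    · rw [degree_C_mul hS]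
      refine (degree_prod_le _ _).trans ?_
      calc ∑ i ∈ S, (ℓ i).degree ≤ ∑ i ∈ S, (1 : WithBot ℕ) := by
            refine Finset.sum_le_sum fun i _ => ?_
            have := degree_linear_le (a := (x i - y i) / 2) (b := (x i + y i) / 2)
            rwa [add_comm] at this
        _ = (S.card : WithBot ℕ) := by simp
        _ ≤ d := by exact_mod_cast not_lt.mp fun h => hS (hc S h)
  have hbd : ∀ t ∈ Set.Icc (-1 : ℝ) 1, |P.eval t| ≤ M := by
    intro t ht
    rw [hev, abs_neg]
    refine hb _ fun i => ?_
    obtain ⟨hx1, hx2⟩ := hx i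
    obtain ⟨hy1, hy2⟩ := hy i
    obtain ⟨ht1, ht2⟩ := ht
    have : (ℓ i).eval t = (x i * (1 + t) + y i * (1 - t)) / 2 := by simp [hℓ]; ring
    rw [this]
    constructor <;> nlinarith
  have hmain := eval_derivative_one_le hM hdeg hbd
  have hder : (derivative P).eval 1 =
      (∑ i, (y i - x i) * multilin (partialCoeff i c) Finset.univ x) / 2 := by
    have h1 : ∀ i, (ℓ i).eval 1 = x i := fun i => by simp [hℓ]; ring
    have h2 : ∀ i, (derivative (ℓ i)).eval 1 = (x i - y i) / 2 := fun i => by simp [hℓ]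
    rw [sum_mul_multilin_partialCoeff, hP]
    simp only [derivative_neg, derivative_sum, derivative_C_mul, derivative_prod_finset, eval_neg,
      eval_finsetSum, eval_mul, eval_C, eval_prod, h1, h2]
    rw [← Finset.sum_neg_distrib, Finset.sum_div]
    refine Finset.sum_congr rfl fun S _ => ?_
    rw [← mul_neg, ← Finset.sum_neg_distrib, mul_div_assoc, Finset.sum_div]
    congr 1
    exact Finset.sum_congr rfl fun i _ => by ring
  linarith

/-- A multilinear polynomial without constant term has sup norm at least a multiple of the sum
of the `L²` norms of its partial derivatives. -/
theorem sum_sqrt_le_of_abs_multilin_le {d : ℕ} {c : Finset ι → ℝ} {M : ℝ} (hd : 1 ≤ d)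
    (hM : 0 < M) (h0 : c ∅ = 0) (hc : ∀ S, d < S.card → c S = 0)
    (hb : ∀ x : ι → ℝ, (∀ i, x i ∈ Set.Icc (-1 : ℝ) 1) → |multilin c Finset.univ x| ≤ M) :
    ∑ i, Real.sqrt (∑ S : Finset ι, if i ∈ S then c S ^ 2 else 0) ≤
      3 ^ (d - 1) * (2 * (d : ℝ) ^ 2 * M) := by
  set w : ℝ := 2 ^ (Finset.univ : Finset ι).card with hw
  have hw0 : 0 < w := by positivity
  set D : ι → Finset ι → ℝ := fun i T => multilin (partialCoeff i c) Finset.univ (vertex T) with hD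
  have hdir : ∀ T : Finset ι, ∑ i, |D i T| -
      multilin (fun S => S.card * c S) Finset.univ (vertex T) ≤ 2 * (d : ℝ) ^ 2 * M := by
    intro T
    have h := sum_sub_mul_partial_le hM hc hb (vertex_mem_Icc T)
      (y := fun i => if D i T < 0 then -1 else 1) (fun i => by split_ifs <;> simp)
    simp only [sub_mul, Finset.sum_sub_distrib, sum_self_mul_multilin_partialCoeff] at h
    convert h using 3 with i
    change |D i T| = (if D i T < 0 then -1 else 1) * D i T
    split_ifs with hneg
    · rw [abs_of_neg hneg]; ring
    · rw [abs_of_nonneg (not_lt.mp hneg)]; ring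
  have hcard : (Finset.univ : Finset (Finset ι)).card = (w : ℝ) := by
    rw [Finset.card_univ, Fintype.card_finset, hw, Finset.card_univ]; push_cast; rfl
  have hsum : ∑ T : Finset ι, ∑ i, |D i T| ≤ w * (2 * (d : ℝ) ^ 2 * M) := by
    -- Summing over all vertices removes the Euler term, whose constant coefficient is zero.
    have h := Finset.sum_le_sum fun (T : Finset ι) (_ : T ∈ Finset.univ) => hdir T
    rw [Finset.sum_sub_distrib, Finset.sum_const, nsmul_eq_mul, hcard, ← Finset.powerset_univ,
      sum_multilin_vertex, h0, mul_zero, mul_zero, sub_zero, Finset.powerset_univ] at h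
    exact h
  have hone : ∀ i, w * Real.sqrt (∑ S : Finset ι, if i ∈ S then c S ^ 2 else 0) ≤
      3 ^ (d - 1) * ∑ T : Finset ι, |D i T| := by
    intro i
    have h := sqrt_sum_sq_le_sum_abs Finset.univ (d - 1) (partialCoeff i c) fun S _ hS => by
      unfold partialCoeff
      split_ifs with hi
      · rfl
      · exact hc _ (by rw [Finset.card_insert_of_notMem hi]; omega)
    rwa [Finset.powerset_univ, sum_sq_partialCoeff] at h
  refine le_of_mul_le_mul_left ?_ hw0
  rw [Finset.mul_sum]
  calc _ ≤ ∑ i, 3 ^ (d - 1) * ∑ T : Finset ι, |D i T| := Finset.sum_le_sum fun i _ => hone i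
    _ = 3 ^ (d - 1) * ∑ T : Finset ι, ∑ i, |D i T| := by rw [← Finset.mul_sum, Finset.sum_comm]
    _ ≤ 3 ^ (d - 1) * (w * (2 * (d : ℝ) ^ 2 * M)) := by gcongr
    _ = _ := by ring

theorem sqrt_sum_sq_le_of_abs_multilin_le {c : Finset ι → ℝ} {M : ℝ} (hM : 0 ≤ M)
    (hb : ∀ x : ι → ℝ, (∀ i, x i ∈ Set.Icc (-1 : ℝ) 1) → |multilin c Finset.univ x| ≤ M) :
    Real.sqrt (∑ S : Finset ι, c S ^ 2) ≤ M := by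
  have h := parseval Finset.univ c
  rw [Finset.powerset_univ] at h
  rw [Real.sqrt_le_left hM]
  refine le_of_mul_le_mul_left ?_ (by positivity : (0 : ℝ) < 2 ^ (Finset.univ : Finset ι).card)
  rw [← h]
  calc _ ≤ ∑ T : Finset ι, M ^ 2 :=
        Finset.sum_le_sum fun T _ => sq_le_sq' (abs_le.mp (hb _ (vertex_mem_Icc T))).1
          (abs_le.mp (hb _ (vertex_mem_Icc T))).2
    _ = _ := by
      rw [Finset.sum_const, nsmul_eq_mul, Finset.card_univ, Fintype.card_finset, Finset.card_univ]
      push_cast; rfl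

end Derivative

end Cube

/-! ### Random signs and exponential moments -/

theorem vertex_eq_or {ι : Type*} [DecidableEq ι] (T : Finset ι) (i : ι) :
    vertex T i = 1 ∨ vertex T i = -1 := by
  unfold vertex; split_ifs <;> simp

theorem prod_eq_one_or_neg_one {ι : Type*} {x : ι → ℝ} (S : Finset ι)
    (hx : ∀ i ∈ S, x i = 1 ∨ x i = -1) : ∏ i ∈ S, x i = 1 ∨ ∏ i ∈ S, x i = -1 :=
  Finset.prod_induction x (fun y => y = 1 ∨ y = -1)
    (by rintro a b (rfl | rfl) (rfl | rfl) <;> simp) (Or.inl rfl) hx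

/-- The exponential moment of a random signed sum of signs. -/
theorem sum_exp_signed_sum {κ : Type*} [DecidableEq κ] (V : Finset κ) (y : κ → ℝ)
    (hy : ∀ S ∈ V, y S = 1 ∨ y S = -1) (s : ℝ) :
    ∑ σ ∈ V.powerset, Real.exp (s * ∑ S ∈ V, vertex σ S * y S) = (2 * Real.cosh s) ^ V.card := by
  have h : ∏ S ∈ V, (Real.exp (s * -y S) + Real.exp (s * y S)) = (2 * Real.cosh s) ^ V.card := by
    rw [← Finset.prod_const]
    refine Finset.prod_congr rfl fun S hS => ?_
    rw [Real.cosh_eq]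
    rcases hy S hS with h | h <;> rw [h] <;> simp <;> ring
  rw [← h, Finset.prod_add]
  refine Finset.sum_congr rfl fun σ hσ => ?_
  rw [Finset.mul_sum, Real.exp_sum, ← Finset.prod_sdiff (Finset.mem_powerset.mp hσ), mul_comm]
  congr 1
  · exact Finset.prod_congr rfl fun S hS => by simp [vertex, hS]
  · exact Finset.prod_congr rfl fun S hS => by simp [vertex, (Finset.mem_sdiff.mp hS).2]

/-- Some signed sum of monomials in the variables `W` is small at all vertices of the cube. -/
theorem exists_signs_abs_sum_le {ι : Type*} [DecidableEq ι] (V : Finset (Finset ι)) (W : Finset ι)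
    (hV : ∀ S ∈ V, S ⊆ W) :
    ∃ ε : Finset ι → ℝ, (∀ S, ε S = 1 ∨ ε S = -1) ∧
      ∀ x : ι → ℝ, (∀ i, x i = 1 ∨ x i = -1) →
        |∑ S ∈ V, ε S * ∏ i ∈ S, x i| ≤ Real.sqrt (2 * ((W.card : ℝ) + 1) * V.card) := by
  set t := Real.sqrt (2 * ((W.card : ℝ) + 1) * V.card) with ht
  rcases V.eq_empty_or_nonempty with rfl | hne
  · exact ⟨fun _ => 1, fun _ => Or.inl rfl, fun x _ => by simp [ht]⟩
  have hm : (0 : ℝ) < V.card := by exact_mod_cast hne.card_pos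
  set m : ℝ := (V.card : ℝ) with hmdef
  set w : ℝ := (W.card : ℝ) with hwdef
  have hw0 : 0 ≤ w := Nat.cast_nonneg _
  have ht2 : t ^ 2 = 2 * (w + 1) * m := Real.sq_sqrt (by positivity)
  have ht0 : 0 < t := Real.sqrt_pos.mpr (by positivity)
  -- Union bound: if every sign pattern were bad, each would contribute at least `exp (s * t)` to
  -- the exponential moments summed over the vertices of `W`.
  by_contra! hcon
  set H : Finset (Finset ι) → Finset ι → ℝ :=
    fun σ T => ∑ S ∈ V, vertex σ S * ∏ i ∈ S, vertex T i with hH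
  have hbig : ∀ σ ∈ V.powerset, ∃ T ∈ W.powerset, t < |H σ T| := by
    intro σ _
    obtain ⟨x, hx, hlt⟩ := hcon (vertex σ) (vertex_eq_or σ)
    refine ⟨W.filter fun i => x i = -1, Finset.mem_powerset.mpr (Finset.filter_subset _ _), ?_⟩
    suffices e : H σ (W.filter fun i => x i = -1) = ∑ S ∈ V, vertex σ S * ∏ i ∈ S, x i by
      rw [e]; exact hlt
    refine Finset.sum_congr rfl fun S hS => ?_
    congr 1
    refine Finset.prod_congr rfl fun i hi => ?_
    have hiW := hV S hS hi
    rcases hx i with h | h <;> (simp [vertex, hiW, h]; try norm_num)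
  -- This minimises `m s² / 2 - s t`. Then `m s² / 2 = w + 1` and `s t = 2 (w + 1)`, so the
  -- comparison reduces to `e ^ (w + 1) ≤ 2 ^ (w + 1)`, which is false.
  set s := t / m with hs
  have hs0 : 0 < s := div_pos ht0 hm
  have hlow : 2 ^ V.card * Real.exp (s * t) ≤
      ∑ σ ∈ V.powerset, ∑ T ∈ W.powerset, (Real.exp (s * H σ T) + Real.exp (-s * H σ T)) := by
    have : (2 : ℝ) ^ V.card * Real.exp (s * t) = ∑ σ ∈ V.powerset, Real.exp (s * t) := by
      rw [Finset.sum_const, nsmul_eq_mul, Finset.card_powerset]; push_cast; rfl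
    rw [this]
    refine Finset.sum_le_sum fun σ hσ => ?_
    obtain ⟨T, hT, hlt⟩ := hbig σ hσ
    refine le_trans ?_ (Finset.single_le_sum (f := fun T => Real.exp (s * H σ T) +
      Real.exp (-s * H σ T)) (fun _ _ => by positivity) hT)
    rcases lt_abs.mp hlt with h | h
    · have := Real.exp_le_exp.mpr (mul_le_mul_of_nonneg_left h.le hs0.le)
      linarith [Real.exp_pos (-s * H σ T)]
    · have := Real.exp_le_exp.mpr (mul_le_mul_of_nonneg_left h.le hs0.le)
      rw [mul_neg, ← neg_mul] at this
      linarith [Real.exp_pos (s * H σ T)]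
  have hup : ∑ σ ∈ V.powerset, ∑ T ∈ W.powerset, (Real.exp (s * H σ T) + Real.exp (-s * H σ T)) =
      2 ^ W.card * (2 * (2 * Real.cosh s) ^ V.card) := by
    rw [Finset.sum_comm]
    have : ∀ T ∈ W.powerset, ∑ σ ∈ V.powerset, (Real.exp (s * H σ T) + Real.exp (-s * H σ T)) =
        2 * (2 * Real.cosh s) ^ V.card := by
      intro T _
      have hy : ∀ S ∈ V, ∏ i ∈ S, vertex T i = 1 ∨ ∏ i ∈ S, vertex T i = -1 := fun S _ =>
        prod_eq_one_or_neg_one S fun i _ => vertex_eq_or T i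
      rw [Finset.sum_add_distrib, sum_exp_signed_sum V _ hy, sum_exp_signed_sum V _ hy,
        Real.cosh_neg]
      ring
    rw [Finset.sum_congr rfl this, Finset.sum_const, nsmul_eq_mul, Finset.card_powerset]
    push_cast; rfl
  have hcosh : Real.cosh s ^ V.card ≤ Real.exp (w + 1) := by
    calc Real.cosh s ^ V.card ≤ Real.exp (s ^ 2 / 2) ^ V.card :=
          pow_le_pow_left₀ (Real.cosh_pos s).le (Real.cosh_le_exp_half_sq s) _
      _ = Real.exp (m * (s ^ 2 / 2)) := by rw [← Real.exp_nat_mul]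
      _ = Real.exp (w + 1) := by
        congr 1
        rw [hs, div_pow, ht2]
        field_simp
  have hst : Real.exp (s * t) = Real.exp (w + 1) * Real.exp (w + 1) := by
    rw [← Real.exp_add]
    congr 1
    rw [hs, div_mul_eq_mul_div, ← sq, ht2]
    field_simp
    ring
  rw [hup, hst, mul_pow] at hlow
  have h2 : Real.exp (w + 1) ≤ 2 ^ (W.card + 1) := by
    have hpos : (0 : ℝ) < 2 ^ V.card * Real.exp (w + 1) := by positivity
    refine le_of_mul_le_mul_left ?_ hpos
    calc 2 ^ V.card * Real.exp (w + 1) * Real.exp (w + 1)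
        ≤ 2 ^ W.card * (2 * (2 ^ V.card * Real.cosh s ^ V.card)) := by linarith
      _ ≤ 2 ^ W.card * (2 * (2 ^ V.card * Real.exp (w + 1))) := by gcongr
      _ = _ := by ring
  have h3 : (2 : ℝ) ^ (W.card + 1) < Real.exp (w + 1) := by
    have he : Real.exp (w + 1) = Real.exp 1 ^ (W.card + 1) := by
      rw [← Real.exp_nat_mul, mul_one]; push_cast; rfl
    rw [he]
    exact pow_lt_pow_left₀ (by linarith [Real.exp_one_gt_d9]) (by norm_num) (by omega)
  linarith

/-! ### Dyadic blocks of variables sorted by degree -/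

/-- The number of edges of `U` containing `a`. -/
def edgeDegree {α : Type*} [DecidableEq α] (U : Finset (Finset α)) (a : α) : ℕ :=
  (U.filter fun S => a ∈ S).card

theorem card_le_sum_edgeDegree {α : Type*} [DecidableEq α] {U V : Finset (Finset α)}
    (hVU : V ⊆ U) (A : Finset α) (hA : ∀ S ∈ V, ∃ a ∈ A, a ∈ S) :
    V.card ≤ ∑ a ∈ A, edgeDegree U a := by
  refine (Finset.card_le_card fun S hS => ?_).trans Finset.card_biUnion_le
  obtain ⟨a, ha, haS⟩ := hA S hS
  exact Finset.mem_biUnion.mpr ⟨a, ha, Finset.mem_filter.mpr ⟨hVU hS, haS⟩⟩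

/-- AM–GM, since `4 · 1.67 · 0.835 > 5`. The ratio 2 between the coefficients is what the dyadic
telescoping needs. -/
theorem sqrt_le_of_add_le {X s B : ℝ} (hX : 0 ≤ X) (hs : 0 ≤ s) (hB : B ≤ 5 * X * s) :
    Real.sqrt B ≤ 1.67 * s + 0.835 * X := by
  rw [Real.sqrt_le_left (by positivity)]
  nlinarith [sq_nonneg (1.67 * s - 0.835 * X), mul_nonneg hX hs]

/-- For edges on `ℕ` with decreasing degrees, signs chosen independently on dyadic blocks. -/
theorem exists_signs_dyadic (U : Finset (Finset ℕ)) (hU : ∀ S ∈ U, S.Nonempty)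
    (hanti : Antitone (edgeDegree U)) (k : ℕ) :
    ∃ ε : Finset ℕ → ℝ, (∀ S, ε S = 1 ∨ ε S = -1) ∧
      ∀ x : ℕ → ℝ, (∀ i, x i = 1 ∨ x i = -1) →
        |∑ S ∈ U.filter (· ⊆ Finset.range (2 ^ (k + 1))), ε S * ∏ i ∈ S, x i| ≤
          3.34 * ∑ j ∈ Finset.range (2 ^ (k + 1)), Real.sqrt (edgeDegree U j) -
            0.835 * (2 ^ (k + 1) : ℕ) * Real.sqrt (edgeDegree U (2 ^ (k + 1))) := by
  set a : ℕ → ℝ := fun j => Real.sqrt (edgeDegree U j) with ha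
  have ha0 : ∀ j, 0 ≤ a j := fun j => Real.sqrt_nonneg _
  have ha2 : ∀ j, (edgeDegree U j : ℝ) = a j ^ 2 := fun j =>
    (Real.sq_sqrt (Nat.cast_nonneg _)).symm
  have haanti : ∀ {i j}, i ≤ j → a j ≤ a i := fun h =>
    Real.sqrt_le_sqrt (by exact_mod_cast hanti h)
  -- The subtracted term is what closes the induction: it pays for the `0.835 b a_b` in the cost of
  -- the next block, and `b a_{2b} ≤ s` lets the spare `1.67 s` restore it at `2b`.
  induction k with
  | zero =>
    set V := U.filter (· ⊆ Finset.range (2 ^ (0 + 1))) with hV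
    obtain ⟨ε, hε, hb⟩ := exists_signs_abs_sum_le V (Finset.range 2)
      fun S hS => (Finset.mem_filter.mp hS).2
    refine ⟨ε, hε, fun x hx => (hb x hx).trans ?_⟩
    have hcard : (V.card : ℝ) ≤ a 0 ^ 2 + a 1 ^ 2 := by
      have := card_le_sum_edgeDegree (Finset.filter_subset _ U : V ⊆ U) (Finset.range 2)
        fun S hS => by
          obtain ⟨hSU, hS2⟩ := Finset.mem_filter.mp hS
          obtain ⟨i, hi⟩ := hU S hSU
          exact ⟨i, hS2 hi, hi⟩
      rw [Finset.sum_range_succ, Finset.sum_range_one] at this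
      rw [← ha2, ← ha2]
      exact_mod_cast this
    have h21 : a 2 ≤ a 1 := haanti (by norm_num)
    have h0 := ha0 0
    have h1 := ha0 1
    have : Real.sqrt (2 * (((Finset.range 2).card : ℝ) + 1) * V.card) ≤
        3.34 * a 0 + 1.67 * a 1 := by
      rw [Real.sqrt_le_left (by positivity), Finset.card_range]
      push_cast
      have h10 : a 1 ≤ a 0 := haanti (by norm_num)
      nlinarith [mul_nonneg h0 h1, mul_nonneg h1 (sub_nonneg.mpr h10), sq_nonneg (a 0)]
    refine this.trans ?_
    norm_num [Finset.sum_range_succ]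
    linarith
  | succ k ih =>
    obtain ⟨ε₁, hε₁, hb₁⟩ := ih
    set b := 2 ^ (k + 1) with hb
    have h2b : 2 ^ (k + 1 + 1) = 2 * b := by rw [hb]; ring
    rw [h2b]
    have hb2 : 2 ≤ b := by
      rw [hb, pow_succ]; have := Nat.one_le_two_pow (n := k); omega
    -- Each new edge meets `[b, 2b)`, so there are at most `∑ a_j² ≤ a_b s` of them, while only `2b`
    -- variables are involved.
    set V := (U.filter (· ⊆ Finset.range (2 * b))).filter (fun S => ¬ S ⊆ Finset.range b) with hV
    obtain ⟨ε₂, hε₂, hb₂⟩ := exists_signs_abs_sum_le V (Finset.range (2 * b))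
      fun S hS => (Finset.mem_filter.mp (Finset.mem_filter.mp hS).1).2
    refine ⟨fun S => if S ⊆ Finset.range b then ε₁ S else ε₂ S, fun S => ?_, fun x hx => ?_⟩
    · dsimp only
      split_ifs
      exacts [hε₁ S, hε₂ S]
    have hsplit : ∑ S ∈ U.filter (· ⊆ Finset.range (2 * b)),
        (if S ⊆ Finset.range b then ε₁ S else ε₂ S) * ∏ i ∈ S, x i =
        ∑ S ∈ U.filter (· ⊆ Finset.range b), ε₁ S * ∏ i ∈ S, x i +
          ∑ S ∈ V, ε₂ S * ∏ i ∈ S, x i := by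
      rw [← Finset.sum_filter_add_sum_filter_not _ (· ⊆ Finset.range b)]
      congr 1
      · have : (U.filter (· ⊆ Finset.range (2 * b))).filter (· ⊆ Finset.range b) =
            U.filter (· ⊆ Finset.range b) := by
          ext S
          simp only [Finset.mem_filter, and_assoc]
          refine ⟨fun h => ⟨h.1, h.2.2⟩, fun h => ⟨h.1, h.2.trans ?_, h.2⟩⟩
          exact Finset.range_subset_range.mpr (by omega)
        rw [this]
        exact Finset.sum_congr rfl fun S hS => by rw [if_pos (Finset.mem_filter.mp hS).2]
      · exact Finset.sum_congr rfl fun S hS => by rw [if_neg (Finset.mem_filter.mp hS).2]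
    rw [hsplit]
    refine (abs_add_le _ _).trans ?_
    have hB₁ := hb₁ x hx
    have hB₂ := hb₂ x hx
    set s := ∑ j ∈ Finset.Ico b (2 * b), a j with hs
    have hs0 : 0 ≤ s := Finset.sum_nonneg fun j _ => ha0 j
    have hbR : (2 : ℝ) ≤ b := by exact_mod_cast hb2
    have hP : ∑ j ∈ Finset.range (2 * b), a j = ∑ j ∈ Finset.range b, a j + s :=
      (Finset.sum_range_add_sum_Ico a (by omega)).symm
    have hslow : b * a (2 * b) ≤ s := by
      have := Finset.card_nsmul_le_sum (Finset.Ico b (2 * b)) a (a (2 * b)) fun j hj =>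
        haanti (Finset.mem_Ico.mp hj).2.le
      rwa [Nat.card_Ico, nsmul_eq_mul, show 2 * b - b = b by omega] at this
    have hcard : (V.card : ℝ) ≤ a b * s := by
      have h := card_le_sum_edgeDegree (((Finset.filter_subset _ _).trans
        (Finset.filter_subset _ U)) : V ⊆ U) (Finset.Ico b (2 * b)) fun S hS => by
          obtain ⟨hS1, hS2⟩ := Finset.mem_filter.mp hS
          obtain ⟨i, hi, hib⟩ := Finset.not_subset.mp hS2
          refine ⟨i, Finset.mem_Ico.mpr ⟨by simpa using hib, ?_⟩, hi⟩
          exact Finset.mem_range.mp ((Finset.mem_filter.mp hS1).2 hi)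
      calc (V.card : ℝ) ≤ ∑ j ∈ Finset.Ico b (2 * b), (edgeDegree U j : ℝ) := by exact_mod_cast h
        _ ≤ ∑ j ∈ Finset.Ico b (2 * b), a b * a j := by
          refine Finset.sum_le_sum fun j hj => ?_
          rw [ha2, sq]
          exact mul_le_mul_of_nonneg_right (haanti (Finset.mem_Ico.mp hj).1) (ha0 j)
        _ = a b * s := by rw [← Finset.mul_sum]
    have hroot : Real.sqrt (2 * (((Finset.range (2 * b)).card : ℝ) + 1) * V.card) ≤
        1.67 * s + 0.835 * (b * a b) := by
      refine sqrt_le_of_add_le (mul_nonneg (by linarith) (ha0 b)) hs0 ?_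
      rw [Finset.card_range]
      push_cast
      -- The 5 comes from `2 (2b + 1) ≤ 5b`, which needs `b ≥ 2`; hence the first block has two
      -- variables.
      calc 2 * (2 * (b : ℝ) + 1) * V.card ≤ 2 * (2 * (b : ℝ) + 1) * (a b * s) := by gcongr
        _ ≤ (5 * b) * (a b * s) :=
          mul_le_mul_of_nonneg_right (by linarith) (mul_nonneg (ha0 b) hs0)
        _ = _ := by ring
    rw [hP]
    push_cast
    linarith

/-! ### Transfer to `family`, `supNorm` and `infNorm` -/

/-- The coefficients of the member of `family U` with signs `c`. -/
def restrictCoeff {n : ℕ} (U : Finset (Finset (Fin n))) (c : Finset (Fin n) → ℝ)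
    (S : Finset (Fin n)) : ℝ := if S ∈ U then c S else 0

theorem eval_family {n : ℕ} (U : Finset (Finset (Fin n))) (c : Finset (Fin n) → ℝ)
    (x : Fin n → ℝ) :
    MvPolynomial.eval x (∑ S ∈ U, MvPolynomial.C (c S) * edgeMonomial S) =
      ∑ S ∈ U, c S * ∏ i ∈ S, x i := by
  simp [edgeMonomial]

theorem sum_eq_multilin {n : ℕ} (U : Finset (Finset (Fin n))) (c : Finset (Fin n) → ℝ)
    (x : Fin n → ℝ) :
    ∑ S ∈ U, c S * ∏ i ∈ S, x i = multilin (restrictCoeff U c) Finset.univ x := by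
  simp [multilin, restrictCoeff, ite_mul]

theorem restrictCoeff_sq {n : ℕ} {U : Finset (Finset (Fin n))} {c : Finset (Fin n) → ℝ}
    (hc : ∀ S ∈ U, c S = 1 ∨ c S = -1) (S : Finset (Fin n)) :
    restrictCoeff U c S ^ 2 = if S ∈ U then 1 else 0 := by
  unfold restrictCoeff
  split_ifs with h
  · rcases hc S h with h | h <;> simp [h]
  · simp

theorem sum_restrictCoeff_sq {n : ℕ} {U : Finset (Finset (Fin n))} {c : Finset (Fin n) → ℝ}
    (hc : ∀ S ∈ U, c S = 1 ∨ c S = -1) :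
    ∑ S : Finset (Fin n), restrictCoeff U c S ^ 2 = U.card := by
  simp [restrictCoeff_sq hc]

theorem sum_restrictCoeff_sq_of_mem {n : ℕ} {U : Finset (Finset (Fin n))}
    {c : Finset (Fin n) → ℝ} (hc : ∀ S ∈ U, c S = 1 ∨ c S = -1) (i : Fin n) :
    (∑ S : Finset (Fin n), if i ∈ S then restrictCoeff U c S ^ 2 else 0) = varDegree U i := by
  simp only [restrictCoeff_sq hc, varDegree, Finset.card_filter]
  push_cast
  rw [← Finset.sum_filter_add_sum_filter_not Finset.univ (· ∈ U)]
  simp only [Finset.filter_univ_mem]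
  rw [Finset.sum_eq_zero (s := Finset.univ.filter (· ∉ U)), add_zero]
  · exact Finset.sum_congr rfl fun S hS => by simp [hS]
  · intro S hS
    simp [(Finset.mem_filter.mp hS).2]

theorem abs_eval_le_supNorm {n : ℕ} {X : Set ℝ} (hX : IsCompact X) (h : MvPolynomial (Fin n) ℝ)
    {x : Fin n → ℝ} (hx : ∀ i, x i ∈ X) : |MvPolynomial.eval x h| ≤ supNorm X h :=
  le_ciSup (bddAbove_supNorm hX h) fun i => ⟨x i, hx i⟩

theorem isCompact_signs : IsCompact ({-1, 1} : Set ℝ) := (Set.toFinite _).isCompact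

/-- The sup norm of a multilinear polynomial over the solid cube is attained at a vertex. -/
theorem supNorm_Icc_eq {n : ℕ} {U : Finset (Finset (Fin n))} {h : MvPolynomial (Fin n) ℝ}
    (hh : h ∈ family U) : supNorm (Set.Icc (-1 : ℝ) 1) h = supNorm ({-1, 1} : Set ℝ) h := by
  have : Nonempty (Set.Icc (-1 : ℝ) 1) := ⟨⟨0, by simp⟩⟩
  have : Nonempty ({-1, 1} : Set ℝ) := ⟨⟨1, by simp⟩⟩
  refine le_antisymm (ciSup_le fun x => ?_) (ciSup_le fun x => ?_)
  · obtain ⟨c, -, rfl⟩ := hh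
    rw [eval_family, sum_eq_multilin]
    refine abs_multilin_le_of_vertex (fun i => (x i).2) _ _ fun T _ => ?_
    rw [← sum_eq_multilin, ← eval_family]
    refine abs_eval_le_supNorm isCompact_signs _ fun i => ?_
    rcases vertex_eq_or T i with h | h <;> simp [h]
  · refine abs_eval_le_supNorm isCompact_Icc _ fun i => ?_
    rcases (x i).2 with h | h
    · rw [h]; simp
    · rw [Set.mem_singleton_iff.mp h]; simp

theorem infNorm_Icc_eq {n : ℕ} (U : Finset (Finset (Fin n))) :
    infNorm (Set.Icc (-1 : ℝ) 1) U = infNorm ({-1, 1} : Set ℝ) U :=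
  iInf_congr fun h => supNorm_Icc_eq h.2

theorem le_infNorm {n : ℕ} {X : Set ℝ} {U : Finset (Finset (Fin n))} {B : ℝ}
    (hB : ∀ h ∈ family U, B ≤ supNorm X h) : B ≤ infNorm X U :=
  have : Nonempty (family U) := (family_nonempty U).to_subtype
  le_ciInf fun h => hB h h.2

theorem infNorm_le_of_signs {n : ℕ} {U : Finset (Finset (Fin n))} {B : ℝ}
    {ε : Finset (Fin n) → ℝ} (hε : ∀ S ∈ U, ε S = 1 ∨ ε S = -1)
    (hB : ∀ x : Fin n → ℝ, (∀ i, x i = 1 ∨ x i = -1) → |∑ S ∈ U, ε S * ∏ i ∈ S, x i| ≤ B) :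
    infNorm (Set.Icc (-1 : ℝ) 1) U ≤ B := by
  rw [infNorm_Icc_eq]
  have hbdd : BddBelow (Set.range fun h : family U =>
      supNorm ({-1, 1} : Set ℝ) (h : MvPolynomial (Fin n) ℝ)) :=
    ⟨0, by rintro _ ⟨h, rfl⟩; exact supNorm_nonneg _ _⟩
  refine (ciInf_le hbdd ⟨_, ε, hε, rfl⟩).trans ?_
  have : Nonempty ({-1, 1} : Set ℝ) := ⟨⟨1, by simp⟩⟩
  refine ciSup_le fun x => ?_
  rw [eval_family]
  refine hB _ fun i => ?_
  rcases (x i).2 with h | h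
  · exact Or.inr h
  · exact Or.inl h

theorem abs_multilin_le_supNorm {n : ℕ} (U : Finset (Finset (Fin n))) (c : Finset (Fin n) → ℝ)
    (x : Fin n → ℝ) (hx : ∀ i, x i ∈ Set.Icc (-1 : ℝ) 1) :
    |multilin (restrictCoeff U c) Finset.univ x| ≤ supNorm (Set.Icc (-1 : ℝ) 1)
      (∑ S ∈ U, MvPolynomial.C (c S) * edgeMonomial S) := by
  rw [← sum_eq_multilin, ← eval_family]
  exact abs_eval_le_supNorm isCompact_Icc _ hx

theorem sqrt_card_le_supNorm {n : ℕ} {U : Finset (Finset (Fin n))} {h : MvPolynomial (Fin n) ℝ}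
    (hh : h ∈ family U) : Real.sqrt U.card ≤ supNorm (Set.Icc (-1 : ℝ) 1) h := by
  obtain ⟨c, hc, rfl⟩ := hh
  rw [← sum_restrictCoeff_sq hc]
  exact sqrt_sum_sq_le_of_abs_multilin_le (supNorm_nonneg _ _) (abs_multilin_le_supNorm U c)

theorem sumSqrt_le_supNorm {n d : ℕ} (hd : 1 ≤ d) {U : Finset (Finset (Fin n))}
    (hU : IsBoundedFamily d U) {h : MvPolynomial (Fin n) ℝ} (hh : h ∈ family U) :
    sumSqrt U ≤ 3 ^ (d - 1) * (2 * (d : ℝ) ^ 2 * supNorm (Set.Icc (-1 : ℝ) 1) h) := by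
  -- The empty family is set apart because the Markov step divides by the norm.
  rcases U.eq_empty_or_nonempty with rfl | hne
  · have := supNorm_nonneg (Set.Icc (-1 : ℝ) 1) h
    have h0 : sumSqrt (∅ : Finset (Finset (Fin n))) = 0 := by simp [sumSqrt, varDegree]
    rw [h0]
    positivity
  have hM : 0 < supNorm (Set.Icc (-1 : ℝ) 1) h :=
    (Real.sqrt_pos.mpr (by exact_mod_cast hne.card_pos)).trans_le (sqrt_card_le_supNorm hh)
  obtain ⟨c, hc, rfl⟩ := hh
  have := sum_sqrt_le_of_abs_multilin_le hd hM (c := restrictCoeff U c)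
    (if_neg fun h0 => Finset.not_nonempty_empty (hU ∅ h0).1)
    (fun S hS => if_neg fun hSU => hS.not_ge (hU S hSU).2) (abs_multilin_le_supNorm U c)
  simpa only [sum_restrictCoeff_sq_of_mem hc, sumSqrt] using this

/-- The constant from Markov's inequality is at least as good as the stated one: `2d² ≤ 4(d - 1)d`
for `d ≥ 2`, and `4 ≤ 2^{5/2}`. -/
theorem explicit_constant_le {d : ℕ} (hd : 2 ≤ d) :
    1 / ((3 : ℝ) ^ (d - 1) * (2 : ℝ) ^ (5 / 2 : ℝ) * ((d : ℝ) - 1) ^ (3 / 2 : ℝ) * (d : ℝ)) ≤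
      1 / (3 ^ (d - 1) * (2 * (d : ℝ) ^ 2)) := by
  have hdR : (2 : ℝ) ≤ d := by exact_mod_cast hd
  have h4 : (4 : ℝ) ≤ 2 ^ (5 / 2 : ℝ) := by
    calc (4 : ℝ) = 2 ^ (2 : ℝ) := by norm_num
      _ ≤ _ := Real.rpow_le_rpow_of_exponent_le (by norm_num) (by norm_num)
  have hd1 : (d : ℝ) - 1 ≤ ((d : ℝ) - 1) ^ (3 / 2 : ℝ) :=
    Real.self_le_rpow_of_one_le (by linarith) (by norm_num)
  refine one_div_le_one_div_of_le (by positivity) ?_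
  rw [mul_assoc, mul_assoc]
  refine mul_le_mul_of_nonneg_left ?_ (by positivity)
  calc 2 * (d : ℝ) ^ 2 ≤ 4 * (((d : ℝ) - 1) * d) := by nlinarith
    _ ≤ _ := mul_le_mul h4 (mul_le_mul_of_nonneg_right hd1 (by linarith))
        (mul_nonneg (by linarith) (by linarith)) (by positivity)

/-- A linear form with coefficients `±1` has sup norm equal to its number of terms. -/
theorem card_le_supNorm_of_linear {n : ℕ} {U : Finset (Finset (Fin n))}
    (hU : IsBoundedFamily 1 U) {h : MvPolynomial (Fin n) ℝ} (hh : h ∈ family U) :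
    (U.card : ℝ) ≤ supNorm (Set.Icc (-1 : ℝ) 1) h := by
  obtain ⟨c, hc, rfl⟩ := hh
  -- At this point every term of the linear form equals 1.
  have hx : ∀ i : Fin n, (if {i} ∈ U then c {i} else 1) ∈ Set.Icc (-1 : ℝ) 1 := fun i => by
    split_ifs with h
    · rcases hc _ h with h | h <;> simp [h]
    · simp
  have := (le_abs_self _).trans (abs_eval_le_supNorm isCompact_Icc
    (∑ S ∈ U, MvPolynomial.C (c S) * edgeMonomial S) hx)
  rw [eval_family, Finset.sum_congr rfl (g := fun _ => (1 : ℝ))] at this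
  · simpa using this
  · intro S hS
    obtain ⟨i, rfl⟩ := Finset.card_eq_one.mp (le_antisymm (hU S hS).2 (hU S hS).1.card_pos)
    rw [Finset.prod_singleton, if_pos hS]
    rcases hc _ hS with h | h <;> simp [h]

/-- Double counting of incidences, with `√k ≤ k` for natural `k`. -/
theorem sumSqrt_le_card {n : ℕ} {U : Finset (Finset (Fin n))} (hU : IsBoundedFamily 1 U) :
    sumSqrt U ≤ U.card := by
  calc sumSqrt U ≤ ∑ i : Fin n, (varDegree U i : ℝ) := by
        refine Finset.sum_le_sum fun i _ => ?_
        rw [Real.sqrt_le_left (Nat.cast_nonneg _)]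
        exact_mod_cast Nat.le_self_pow two_ne_zero _
    _ = ((∑ S ∈ U, S.card : ℕ) : ℝ) := by
        rw [← Nat.cast_sum]
        simp only [varDegree, Finset.card_filter]
        rw [Finset.sum_comm]
        simp
    _ ≤ U.card := by
        rw [Finset.card_eq_sum_ones]
        exact_mod_cast Finset.sum_le_sum fun S hS => (hU S hS).2

/-- An enumeration of the variables by decreasing degree. -/
theorem exists_antitone_enumeration {n : ℕ} (u : Fin n → ℕ) :
    ∃ e : Equiv.Perm (Fin n), Antitone (u ∘ e) := by
  refine ⟨Tuple.sort (fun i => OrderDual.toDual (u i)), fun i j hij => ?_⟩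
  exact Tuple.monotone_sort (fun i => OrderDual.toDual (u i)) hij

/-- Sorted variables are embedded in `ℕ`, where degrees vanish from `n` on. Degrees thus stay
antitone, and rounding up to a power of two costs nothing. -/
theorem infNorm_le_sumSqrt {n : ℕ} {U : Finset (Finset (Fin n))} (hU : ∀ S ∈ U, S.Nonempty) :
    infNorm (Set.Icc (-1 : ℝ) 1) U ≤ 3.34 * sumSqrt U := by
  obtain ⟨e, he⟩ := exists_antitone_enumeration (varDegree U)
  set f : Fin n ↪ ℕ := e.symm.toEmbedding.trans Fin.valEmbedding with hf
  have hfval : ∀ i, f i = (e.symm i).val := fun i => rfl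
  have hfe : ∀ j, f (e j) = j.val := fun j => by rw [hfval, Equiv.symm_apply_apply]
  set U' : Finset (Finset ℕ) := U.map (Finset.mapEmbedding f).toEmbedding with hU'
  have hsub : ∀ S ∈ U', S ⊆ Finset.range n := by
    intro S hS
    obtain ⟨S, -, rfl⟩ := Finset.mem_map.mp hS
    intro j hj
    obtain ⟨i, -, rfl⟩ := Finset.mem_map.mp hj
    exact Finset.mem_range.mpr (e.symm i).isLt
  have hdeg : ∀ i, edgeDegree U' (f i) = varDegree U i := by
    intro i
    unfold edgeDegree varDegree
    rw [hU', Finset.filter_map, Finset.card_map]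
    congr 1
    ext S
    simp
  have hdeg0 : ∀ j, n ≤ j → edgeDegree U' j = 0 := by
    intro j hj
    refine Finset.card_eq_zero.mpr (Finset.filter_eq_empty_iff.mpr fun S hS h => ?_)
    have := Finset.mem_range.mp (hsub S hS h)
    omega
  have hanti : Antitone (edgeDegree U') := by
    intro i j hij
    rcases lt_or_ge j n with hj | hj
    · have hi := hij.trans_lt hj
      have hf' : ∀ k (hk : k < n), edgeDegree U' k = varDegree U (e ⟨k, hk⟩) := fun k hk => by
        rw [← hdeg, hfe]
      rw [hf' i hi, hf' j hj]
      exact he (Fin.mk_le_mk.mpr hij)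
    · rw [hdeg0 j hj]; exact Nat.zero_le _
  have hne : ∀ S ∈ U', S.Nonempty := by
    intro S hS
    obtain ⟨S, hSU, rfl⟩ := Finset.mem_map.mp hS
    exact (hU S hSU).map
  obtain ⟨ε, hε, hB⟩ := exists_signs_dyadic U' hne hanti n
  have hn : n ≤ 2 ^ (n + 1) := Nat.lt_two_pow_self.le.trans
    (Nat.pow_le_pow_right two_pos (Nat.le_succ n))
  have hfilter : U'.filter (· ⊆ Finset.range (2 ^ (n + 1))) = U' :=
    Finset.filter_true_of_mem fun S hS =>
      (hsub S hS).trans (Finset.range_subset_range.mpr hn)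
  have hsum : ∑ j ∈ Finset.range (2 ^ (n + 1)), Real.sqrt (edgeDegree U' j) = sumSqrt U := by
    rw [← Finset.sum_subset (Finset.range_subset_range.mpr hn) fun j _ hj => by
      rw [hdeg0 j (by simpa using hj)]; simp, Finset.sum_range, sumSqrt,
      ← Equiv.sum_comp e fun i => Real.sqrt (varDegree U i)]
    exact Finset.sum_congr rfl fun j _ => by rw [← hdeg, hfe]
  rw [hfilter, hsum] at hB
  refine infNorm_le_of_signs (ε := fun S => ε (S.map f)) (fun S _ => hε _) fun x hx => ?_
  -- The padding value 1 only has to be a sign; no edge of `U'` uses those variables.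
  have h := hB (fun j => if hj : j < n then x (e ⟨j, hj⟩) else 1) fun j => by
    split_ifs
    · exact hx _
    · exact Or.inl rfl
  have heq : ∑ S ∈ U', ε S * ∏ j ∈ S, (if hj : j < n then x (e ⟨j, hj⟩) else 1) =
      ∑ S ∈ U, ε (S.map f) * ∏ i ∈ S, x i := by
    rw [hU', Finset.sum_map]
    refine Finset.sum_congr rfl fun S _ => ?_
    simp only [RelEmbedding.coe_toEmbedding, Finset.mapEmbedding_apply, Finset.prod_map]
    congr 1
    refine Finset.prod_congr rfl fun i _ => ?_
    rw [dif_pos (show f i < n from (e.symm i).isLt)]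
    exact congrArg x (e.apply_symm_apply i)
  rw [heq] at h
  refine h.trans (sub_le_self _ (by positivity))

theorem infNorm_le_sqrt_card {n : ℕ} (U : Finset (Finset (Fin n))) :
    infNorm (Set.Icc (-1 : ℝ) 1) U ≤ Real.sqrt (2 * ((n : ℝ) + 1) * (U.card : ℝ)) := by
  obtain ⟨ε, hε, hB⟩ := exists_signs_abs_sum_le U Finset.univ fun S _ => Finset.subset_univ S
  rw [Finset.card_univ, Fintype.card_fin] at hB
  exact infNorm_le_of_signs (fun S _ => hε S) hB

theorem mul_sumSqrt_le_infNorm {n d : ℕ} (hd : 1 ≤ d) {U : Finset (Finset (Fin n))}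
    (hU : IsBoundedFamily d U) :
    1 / (3 ^ (d - 1) * (2 * (d : ℝ) ^ 2)) * sumSqrt U ≤ infNorm (Set.Icc (-1 : ℝ) 1) U := by
  have hdR : (0 : ℝ) < d := by exact_mod_cast hd
  refine le_infNorm fun h hh => ?_
  rw [one_div, inv_mul_le_iff₀ (by positivity), mul_assoc]
  exact sumSqrt_le_supNorm hd hU hh

end Littlewood

end

theorem theorem1 :
    -- for fixed `d`, the infimum is of order `∑ √u_i`, with constants depending only on `d`
    (∀ d : ℕ, 1 ≤ d → ∃ c C : ℝ, 0 < c ∧ 0 < C ∧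
      ∀ (n : ℕ) (U : Finset (Finset (Fin n))), Littlewood.IsBoundedFamily d U →
        c * Littlewood.sumSqrt U ≤ Littlewood.infNorm (Set.Icc (-1 : ℝ) 1) U ∧
        Littlewood.infNorm (Set.Icc (-1 : ℝ) 1) U ≤ C * Littlewood.sumSqrt U) ∧
    -- the explicit bounds, for every `d`
    (∀ (d n : ℕ) (U : Finset (Finset (Fin n))), 1 ≤ d → Littlewood.IsBoundedFamily d U →
      (2 ≤ d →
        max (1 / ((3 : ℝ) ^ (d - 1) * (2 : ℝ) ^ (5 / 2 : ℝ) * ((d : ℝ) - 1) ^ (3 / 2 : ℝ) * (d : ℝ))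
              * Littlewood.sumSqrt U)
            (Real.sqrt (U.card : ℝ))
          ≤ Littlewood.infNorm (Set.Icc (-1 : ℝ) 1) U) ∧
      (d = 1 →
        max (Littlewood.sumSqrt U) (Real.sqrt (U.card : ℝ))
          ≤ Littlewood.infNorm (Set.Icc (-1 : ℝ) 1) U) ∧
      Littlewood.infNorm (Set.Icc (-1 : ℝ) 1) U
        ≤ min (3.34 * Littlewood.sumSqrt U)
            (Real.sqrt (2 * ((n : ℝ) + 1) * (U.card : ℝ))) ∧
      -- the sup norm on the cube and the maximum over its vertices are the same
      (∀ h ∈ Littlewood.family U,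
        Littlewood.supNorm (Set.Icc (-1 : ℝ) 1) h = Littlewood.supNorm ({-1, 1} : Set ℝ) h) ∧
      Littlewood.infNorm (Set.Icc (-1 : ℝ) 1) U = Littlewood.infNorm ({-1, 1} : Set ℝ) U) := by
  
  have hsum0 : ∀ {n : ℕ} (U : Finset (Finset (Fin n))), 0 ≤ Littlewood.sumSqrt U := fun U =>
    Finset.sum_nonneg fun _ _ => Real.sqrt_nonneg _
  refine ⟨fun d hd => ?_, fun d n U hd hU => ⟨fun hd2 => ?_, fun hd1 => ?_, ?_, ?_, ?_⟩⟩
  · have hdR : (0 : ℝ) < d := by exact_mod_cast hd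
    exact ⟨1 / (3 ^ (d - 1) * (2 * (d : ℝ) ^ 2)), 3.34, by positivity, by norm_num, fun n U hU =>
      ⟨Littlewood.mul_sumSqrt_le_infNorm hd hU,
        Littlewood.infNorm_le_sumSqrt fun S hS => (hU S hS).1⟩⟩
  · refine max_le ?_ (Littlewood.le_infNorm fun h hh => Littlewood.sqrt_card_le_supNorm hh)
    exact (mul_le_mul_of_nonneg_right (Littlewood.explicit_constant_le hd2) (hsum0 U)).trans
      (Littlewood.mul_sumSqrt_le_infNorm hd hU)
  · subst hd1
    exact max_le (Littlewood.le_infNorm fun h hh =>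
        (Littlewood.sumSqrt_le_card hU).trans (Littlewood.card_le_supNorm_of_linear hU hh))
      (Littlewood.le_infNorm fun h hh => Littlewood.sqrt_card_le_supNorm hh)
  · exact le_min (Littlewood.infNorm_le_sumSqrt fun S hS => (hU S hS).1)
      (Littlewood.infNorm_le_sqrt_card U)
  · exact fun h hh => Littlewood.supNorm_Icc_eq hh
  · exact Littlewood.infNorm_Icc_eq U
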